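/- A linear chord diagram on $2n$ vertices is a partition of the linearly ordered vertices $1,\dots,2n$ into $n$ pairs (chords); a chord is short if it joins two adjacent vertices. A bubble of a diagram is a non-empty set of consecutive vertices, none of which is an endpoint of a short chord, that is bounded on each side by a short chord or by an end of the diagram; its size is its number of vertices. Let $B_{n,p}$ be the total number of bubbles of size $p$ over all $(2n-1)!!$ linear chord diagrams on $2n$ vertices. Theorem 6. The asymptotic distribution $\rho(x)$ of the rescaled size $x=p/(n-1)$ of bubbles, excluding the diagrams that are themselves a single bubble (of size $2n$), is given for $x\in(0,2]$ by $$\rho(x)=\lim_{n\to\infty}\frac{(n-1)\,B_{n,x(n-1)}}{\sum_{p=1}^{2n-2}B_{n,p}}=\frac{e\,(6-x)}{2\,(4e-2)}\,e^{-x/2}.$$ Here $x(n-1)$ need not be an integer, and the limit is understood as follows: for every $x\in(0,2]$ and every sequence of integers $0\le p_n\le 2n-2$ with $p_n/(n-1)\to x$, $$\lim_{n\to\infty}\frac{(n-1)\,B_{n,p_n}}{\sum_{p=1}^{2n-2}B_{n,p}}=\frac{e\,(6-x)}{2\,(4e-2)}\,e^{-x/2}.$$ -/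

import Mathlib

open Filter Topology

/-- A linear chord diagram with `n` chords: the vertices are `0, 1, …, 2n - 1` in linear order, and
each vertex is joined by a chord to exactly one different vertex. The diagram is given by the map
sending a vertex to the other endpoint of its chord, an involution without fixed points. -/
abbrev LinearChordDiagram (n : ℕ) : Type :=
  {σ : Fin (2 * n) → Fin (2 * n) // ∀ i, σ (σ i) = i ∧ σ i ≠ i}

namespace LinearChordDiagram

/-- The vertex `i` is an endpoint of a short chord, i.e. it is joined to the vertex directly after
it or to the vertex directly before it. -/
def OnShortChord {n : ℕ} (D : LinearChordDiagram n) (i : Fin (2 * n)) : Prop :=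
  (D.1 i : ℕ) = (i : ℕ) + 1 ∨ (i : ℕ) = (D.1 i : ℕ) + 1

instance {n : ℕ} (D : LinearChordDiagram n) (i : Fin (2 * n)) : Decidable (D.OnShortChord i) :=
  inferInstanceAs (Decidable (_ ∨ _))

/-- A bubble: a non-empty set `{a, a + 1, …, b}` of consecutive vertices, none of which is on a
short chord, which is bounded on the left by the start of the diagram or a short chord, and on
the right by the end of the diagram or a short chord. -/
def IsBubble {n : ℕ} (D : LinearChordDiagram n) (S : Finset (Fin (2 * n))) : Prop :=
  ∃ a b : Fin (2 * n), a ≤ b ∧ S = Finset.Icc a b ∧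
    (∀ i ∈ S, ¬ D.OnShortChord i) ∧
    (∀ c : Fin (2 * n), (c : ℕ) + 1 = (a : ℕ) → D.OnShortChord c) ∧
    (∀ c : Fin (2 * n), (c : ℕ) = (b : ℕ) + 1 → D.OnShortChord c)

instance {n : ℕ} (D : LinearChordDiagram n) : DecidablePred D.IsBubble := fun S => by
  unfold IsBubble
  infer_instance

/-- The set of bubbles of a linear chord diagram. -/
def bubbles {n : ℕ} (D : LinearChordDiagram n) : Finset (Finset (Fin (2 * n))) :=
  Finset.univ.filter fun S => D.IsBubble S

end LinearChordDiagram

/-- `B_{n,p}`: the total number of bubbles of size `p` found among all linear chord diagrams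
on `2n` vertices. -/
def bubbleCount (n p : ℕ) : ℕ :=
  ∑ D : LinearChordDiagram n, (D.bubbles.filter fun S => S.card = p).card

/-! A short chord bounding a bubble must point away from it. So a bubble of size p at a given
position amounts to one or two forced chords (none if it fills the diagram) and a pairing of the
remaining points joining no two consecutive bubble vertices (`LinearChordDiagram.isBubbleAt_iff`).
Let A_m(p) be `pathAvoiding m p`, the number of such pairings of 2m points. For n = m + 2 there are
two end positions and 2m + 1 - p interior ones, whence `LinearChordDiagram.bubbleCount_eq`.

The recursion A_{m+1}(p+2) = A_{m+1}(p+1) - A_m(p) makes the sum over p telescope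
(`sum_bubbleCount`). By the inclusion-exclusion formula and dominated convergence, A_m(p)/(2m-1)!!
tends to e^{-y/2} when p/m tends to y (`tendsto_pathAvoiding`).

After division by (2n-1)!!, the numerator (n-1)B_{n,p} tends to (1/2)(2 + 1 - x/2)e^{-x/2} and the
total to 2 - e^{-1}, where e^{-1} is the proportion of excluded one-bubble diagrams. -/

/-! ### Pairings and deletion of a pair -/

/-- A pairing of the elements of `V`, given as an involution without fixed points. -/
abbrev Pairing (V : Type) : Type := {σ : V → V // ∀ i, σ (σ i) = i ∧ σ i ≠ i}

namespace Pairing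

variable {V : Type}

lemma apply_apply (σ : Pairing V) (i : V) : σ.1 (σ.1 i) = i := (σ.2 i).1

lemma apply_ne (σ : Pairing V) (i : V) : σ.1 i ≠ i := (σ.2 i).2

lemma apply_eq_iff (σ : Pairing V) {i j : V} : σ.1 i = j ↔ σ.1 j = i := by
  constructor <;> rintro rfl <;> exact σ.apply_apply _

/-- Deleting a pair `{u, v}` from a pairing. -/
def restrict (σ : Pairing V) {u v : V} (h : σ.1 u = v) : Pairing {w : V // w ≠ u ∧ w ≠ v} :=
  ⟨fun w => ⟨σ.1 w.1,
    fun e => w.2.2 (by rw [σ.apply_eq_iff] at e; exact e.symm.trans h),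
    fun e => w.2.1 (by rw [σ.apply_eq_iff] at h e; exact e.symm.trans h)⟩,
   fun w => ⟨Subtype.ext (σ.apply_apply _), fun e => σ.apply_ne _ (congrArg Subtype.val e)⟩⟩

open Classical in
/-- Adding a pair `{u, v}` to a pairing of the other elements. -/
noncomputable def extend {u v : V} (h : u ≠ v) (τ : Pairing {w : V // w ≠ u ∧ w ≠ v}) :
    Pairing V :=
  ⟨fun w => if hw : w ≠ u ∧ w ≠ v then (τ.1 ⟨w, hw⟩).1 else if w = u then v else u, by
    intro w
    by_cases hw : w ≠ u ∧ w ≠ v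
    · have h1 := (τ.1 ⟨w, hw⟩).2
      simp only [hw, h1, dif_pos, ne_eq, not_false_eq_true, and_self]
      refine ⟨congrArg Subtype.val (τ.apply_apply ⟨w, hw⟩), fun e => ?_⟩
      exact τ.apply_ne ⟨w, hw⟩ (Subtype.ext e)
    · by_cases hu : w = u
      · subst hu
        simp [h.symm]
      · have hv : w = v := by tauto
        subst hv
        simp [h, h.symm]⟩

lemma extend_left {u v : V} (h : u ≠ v) (τ : Pairing {w : V // w ≠ u ∧ w ≠ v}) :
    (extend h τ).1 u = v := by simp [extend]

lemma restrict_extend {u v : V} (h : u ≠ v) (τ : Pairing {w : V // w ≠ u ∧ w ≠ v}) :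
    (extend h τ).restrict (extend_left h τ) = τ := by
  apply Subtype.ext
  funext w
  apply Subtype.ext
  simp [extend, restrict, w.2.1, w.2.2]

lemma extend_restrict (σ : Pairing V) {u v : V} (h : u ≠ v) (hσ : σ.1 u = v) :
    extend h (σ.restrict hσ) = σ := by
  apply Subtype.ext
  funext w
  by_cases hu : w = u
  · subst hu
    simp [extend, hσ]
  · by_cases hv : w = v
    · subst hv
      simp [extend, ← hσ, σ.apply_apply]
    · simp [extend, restrict, hu, hv]

/-- Restriction and extension are mutually inverse, so a forced pair can be deleted from any
counting problem whose condition `Q` survives deletion as `Q'`. -/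
lemma ncard_apply_eq {u v : V} (h : u ≠ v) (Q : Pairing V → Prop)
    (Q' : Pairing {w : V // w ≠ u ∧ w ≠ v} → Prop)
    (hQ : ∀ (σ : Pairing V) (hσ : σ.1 u = v), Q σ ↔ Q' (σ.restrict hσ)) :
    {σ : Pairing V | σ.1 u = v ∧ Q σ}.ncard = {τ | Q' τ}.ncard := by
  refine Set.ncard_congr (fun σ hσ => σ.restrict hσ.1) ?_ ?_ ?_
  · intro σ hσ
    exact (hQ σ hσ.1).1 hσ.2
  · intro σ τ hσ hτ e
    rw [← extend_restrict σ h hσ.1, e, extend_restrict τ h hτ.1]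
  · intro τ hτ
    refine ⟨extend h τ, ⟨extend_left h τ, (hQ _ (extend_left h τ)).2 ?_⟩, restrict_extend h τ⟩
    rwa [restrict_extend]

lemma card_ne_ne [Finite V] {u v : V} (h : u ≠ v) {k : ℕ} (hV : Nat.card V = k + 2) :
    Nat.card {w : V // w ≠ u ∧ w ≠ v} = k := by
  classical
  have := Fintype.ofFinite V
  rw [Nat.card_eq_fintype_card] at hV ⊢
  rw [Fintype.card_subtype]
  have : (Finset.univ.filter fun w : V => w ≠ u ∧ w ≠ v) = (Finset.univ.erase u).erase v := by
    ext w; simp [and_comm]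
  rw [this, Finset.card_erase_of_mem (by simp [h.symm]), Finset.card_erase_of_mem (by simp),
    Finset.card_univ, hV]
  omega

end Pairing

/-! ### Counting pairings, and pairings avoiding a path -/

/-- The number `(2m - 1)!!` of pairings of `2m` points. -/
def oddFactorial (m : ℕ) : ℕ := ∏ i ∈ Finset.range m, (2 * i + 1)

lemma oddFactorial_zero : oddFactorial 0 = 1 := rfl

lemma oddFactorial_succ (m : ℕ) : oddFactorial (m + 1) = (2 * m + 1) * oddFactorial m := by
  rw [oddFactorial, Finset.prod_range_succ, mul_comm]; rfl

lemma oddFactorial_pos (m : ℕ) : 0 < oddFactorial m :=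
  Finset.prod_pos fun _ _ => by omega

/-- A fixed point has 2m - 1 possible partners, and each choice leaves a pairing of 2m - 2 points.
-/
lemma card_pairing (m : ℕ) : ∀ (V : Type) [Finite V], Nat.card V = 2 * m →
    Nat.card (Pairing V) = oddFactorial m := by
  classical
  induction m with
  | zero =>
    intro V _ hV
    have : IsEmpty V := Finite.card_eq_zero_iff.1 (by simpa using hV)
    rw [oddFactorial_zero, Nat.card_eq_one_iff_unique]
    exact ⟨⟨fun σ τ => Subtype.ext (Subsingleton.elim _ _)⟩, ⟨isEmptyElim, isEmptyElim⟩⟩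
  | succ m ih =>
    intro V _ hV
    have := Fintype.ofFinite V
    obtain ⟨u⟩ : Nonempty V := (Nat.card_pos_iff.1 (by omega)).1
    have key : ∀ v, Nat.card {σ : Pairing V // σ.1 u = v} =
        if v ∈ Finset.univ.erase u then oddFactorial m else 0 := by
      intro v
      split_ifs with hv
      · have huv : u ≠ v := (Finset.ne_of_mem_erase hv).symm
        have := Pairing.ncard_apply_eq huv (fun _ => True) (fun _ => True) (by simp)
        simp only [and_true, Set.ofPred_true, Set.ncard_univ] at this
        rw [ih _ (Pairing.card_ne_ne huv (by omega))] at this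
        exact this
      · obtain rfl : v = u := by simpa using hv
        rw [Nat.card_eq_zero]
        exact Or.inl ⟨fun σ => σ.1.apply_ne _ σ.2⟩
    rw [← Nat.card_congr (Equiv.sigmaFiberEquiv fun σ : Pairing V => σ.1 u), Nat.card_sigma,
      Finset.sum_congr rfl fun v _ => key v, Finset.sum_ite_mem, Finset.univ_inter,
      Finset.sum_const, Finset.card_erase_of_mem (Finset.mem_univ _),
      Finset.card_univ, ← Nat.card_eq_fintype_card, hV, oddFactorial_succ, smul_eq_mul]
    congr 1

/-- The number of pairings of `2m` points in which no two consecutive points of a given path on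
`p` of the points are paired. -/
noncomputable def pathAvoiding (m p : ℕ) : ℝ :=
  ∑ j ∈ Finset.range (m + 1), (-1) ^ j * ((p - j).choose j : ℝ) * (oddFactorial (m - j) : ℝ)

lemma pathAvoiding_zero (m : ℕ) : pathAvoiding m 0 = oddFactorial m := by
  rw [pathAvoiding, Finset.sum_range_succ', Finset.sum_eq_zero]
  · simp
  · intro j _; simp

lemma pathAvoiding_one (m : ℕ) : pathAvoiding m 1 = oddFactorial m := by
  rw [pathAvoiding, Finset.sum_range_succ', Finset.sum_eq_zero]
  · simp
  · intro j _; simp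

/-- Pascal's rule for the binomials, which count the j-edge matchings of a path; the shift of j by
one lowers m and flips the sign. -/
lemma pathAvoiding_add_two (m p : ℕ) :
    pathAvoiding (m + 1) (p + 2) = pathAvoiding (m + 1) (p + 1) - pathAvoiding m p := by
  unfold pathAvoiding
  rw [Finset.sum_range_succ' _ (m + 1), Finset.sum_range_succ' _ (m + 1)]
  have : ∀ j, (p + 2 - (j + 1)).choose (j + 1) =
      (p + 1 - (j + 1)).choose (j + 1) + (p - j).choose j := by
    intro j
    rcases le_or_gt j p with h | h
    · rw [show p + 2 - (j + 1) = (p - j) + 1 by omega, Nat.choose_succ_succ,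
        show p + 1 - (j + 1) = p - j by omega, add_comm]
    -- Truncated subtraction makes every upper index 0, and j > p forces j ≥ 1, so all three
    -- binomials vanish.
    · rw [show p + 2 - (j + 1) = 0 by omega, show p + 1 - (j + 1) = 0 by omega,
        show p - j = 0 by omega]
      obtain ⟨k, rfl⟩ : ∃ k, j = k + 1 := ⟨j - 1, by omega⟩
      simp
  simp only [this, Nat.add_sub_add_right]
  push_cast
  simp only [pow_zero, Nat.choose_zero_right, Nat.cast_one, mul_one, one_mul]
  rw [add_sub_right_comm, ← Finset.sum_sub_distrib]
  congr 1
  apply Finset.sum_congr rfl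
  intro j _
  ring

/-- No two consecutive points of the path `f` are paired. -/
def Pairing.Avoids {V : Type} {p : ℕ} (f : Fin p → V) (σ : Pairing V) : Prop :=
  ∀ i j : Fin p, (j : ℕ) = i + 1 → σ.1 (f i) ≠ f j

namespace Pairing

lemma avoids_restrict {V : Type} {u v : V} {p : ℕ} (f : Fin p → V)
    (hf : ∀ i, f i ≠ u ∧ f i ≠ v) (σ : Pairing V) (hσ : σ.1 u = v) :
    (σ.restrict hσ).Avoids (fun i => (⟨f i, hf i⟩ : {w : V // w ≠ u ∧ w ≠ v})) ↔ σ.Avoids f := by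
  simp [Avoids, restrict, Subtype.ext_iff]

/-- Among pairings avoiding the path without its last vertex, discard those joining the last two
vertices; deleting that pair leaves a path on p vertices to avoid. This is the recursion of
`pathAvoiding_add_two`. The vertex type must vary, since deletion changes it. -/
lemma ncard_avoids (p : ℕ) : ∀ (V : Type) [Finite V] (m : ℕ), Nat.card V = 2 * m →
    ∀ f : Fin p → V, Function.Injective f →
    ({σ : Pairing V | σ.Avoids f}.ncard : ℝ) = pathAvoiding m p := by
  induction p using Nat.strong_induction_on with
  | _ p ih =>
  intro V _ m hV f hf
  match p, ih, f, hf with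
  | 0, _, f, _ =>
    rw [pathAvoiding_zero, ← card_pairing m V hV, ← Set.ncard_univ]
    congr 2
    refine Set.eq_univ_of_forall ?_
    intro σ _ i
    exact i.elim0
  | 1, _, f, _ =>
    rw [pathAvoiding_one, ← card_pairing m V hV, ← Set.ncard_univ]
    congr 2
    refine Set.eq_univ_of_forall ?_
    intro σ _ i j h
    omega
  | p + 2, ih, f, hf =>
    have hcard : p + 2 ≤ 2 * m := by
      simpa [hV] using Nat.card_le_card_of_injective f hf
    obtain ⟨m, rfl⟩ : ∃ k, m = k + 1 := ⟨m - 1, by omega⟩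
    set u := f ⟨p, by omega⟩
    set v := f ⟨p + 1, by omega⟩
    have huv : u ≠ v := fun e => by simpa using hf e
    let g : Fin (p + 1) → V := fun i => f i.castSucc
    have hg : Function.Injective g := hf.comp (Fin.castSucc_injective _)
    let k : Fin p → V := fun i => f i.castSucc.castSucc
    have hk : ∀ i, k i ≠ u ∧ k i ≠ v := fun i =>
      ⟨fun e => by have := congrArg Fin.val (hf e); simp at this; omega,
       fun e => by have := congrArg Fin.val (hf e); simp at this; omega⟩
    have h1 := ih (p + 1) (by omega) V (m + 1) hV g hg
    have h2 := ih p (by omega) {w : V // w ≠ u ∧ w ≠ v} m (card_ne_ne huv (by omega))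
      (fun i => ⟨k i, hk i⟩) (fun i j e => by
        have := congrArg Subtype.val e
        have := hf this
        simpa using this)
    rw [← ncard_apply_eq huv (Avoids g)] at h2
    · rw [pathAvoiding_add_two, ← h1, ← h2, eq_sub_iff_add_eq, ← Nat.cast_add,
        ← Set.ncard_inter_add_ncard_sdiff_eq_ncard {σ : Pairing V | σ.Avoids g} {σ | σ.1 u ≠ v}]
      congr 3
      · ext σ
        simp only [Set.mem_inter_iff, Set.mem_ofPred_eq]
        constructor
        · intro h
          exact ⟨fun i j hij => h _ _ (by simpa using hij), h _ _ rfl⟩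
        · rintro ⟨h, h'⟩ i j hij
          by_cases hj : (j : ℕ) = p + 1
          · have e1 : i = ⟨p, by omega⟩ := Fin.ext (by simp; omega)
            have e2 : j = ⟨p + 1, by omega⟩ := Fin.ext hj
            rw [e1, e2]
            exact h'
          · exact h ⟨i, by omega⟩ ⟨j, by omega⟩ hij
      · ext σ
        simp only [Set.mem_sdiff, Set.mem_ofPred_eq, not_not, ne_eq]
        exact and_comm
    · intro σ hσ
      rw [avoids_restrict k hk]
      constructor
      · intro h i j hij
        exact h i.castSucc j.castSucc (by simpa using hij)
      · intro h i j hij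
        -- The edge ending at `u` is avoided automatically, because `u` is already paired with `v`.
        by_cases hj : (j : ℕ) = p
        · have e2 : g j = u := congrArg f (Fin.ext (by simp [hj]))
          rw [e2]
          intro e
          rw [σ.apply_eq_iff, hσ] at e
          have := congrArg Fin.val (hf e)
          simp at this
          omega
        · exact h ⟨i, by omega⟩ ⟨j, by omega⟩ hij

lemma ncard_apply_eq_and_avoids {V : Type} [Finite V] {m p : ℕ}
    (hV : Nat.card V = 2 * (m + 1)) (f : Fin p → V) (hf : Function.Injective f) {u v : V}
    (huv : u ≠ v) (hfuv : ∀ i, f i ≠ u ∧ f i ≠ v) :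
    ({σ : Pairing V | σ.1 u = v ∧ σ.Avoids f}.ncard : ℝ) =
      pathAvoiding m p := by
  rw [ncard_apply_eq huv (Avoids f) (Avoids fun i => ⟨f i, hfuv i⟩)
    (fun σ hσ => (avoids_restrict f hfuv σ hσ).symm)]
  exact ncard_avoids p _ m (card_ne_ne huv (by omega)) _
    fun i j e => hf (congrArg Subtype.val e)

lemma ncard_apply_eq_and_apply_eq_and_avoids {V : Type} [Finite V] {m p : ℕ}
    (hV : Nat.card V = 2 * (m + 2)) (f : Fin p → V) (hf : Function.Injective f) {u v u' v' : V}
    (huv : u ≠ v) (hu'v' : u' ≠ v') (hu' : u' ≠ u ∧ u' ≠ v) (hv' : v' ≠ u ∧ v' ≠ v)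
    (hfuv : ∀ i, f i ≠ u ∧ f i ≠ v) (hfuv' : ∀ i, f i ≠ u' ∧ f i ≠ v') :
    ({σ : Pairing V | σ.1 u = v ∧ σ.1 u' = v' ∧ σ.Avoids f}.ncard : ℝ) = pathAvoiding m p := by
  rw [ncard_apply_eq huv (fun σ => σ.1 u' = v' ∧ σ.Avoids f)
    (fun τ => τ.1 ⟨u', hu'⟩ = ⟨v', hv'⟩ ∧ τ.Avoids fun i => ⟨f i, hfuv i⟩)
    (fun σ hσ => by rw [avoids_restrict f hfuv σ hσ]; simp [restrict])]
  exact ncard_apply_eq_and_avoids (card_ne_ne huv (by omega)) _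
    (fun i j e => hf (congrArg Subtype.val e)) (by simpa using hu'v') (by simpa using hfuv')

end Pairing

/-! ### Counting bubbles by position -/

namespace LinearChordDiagram

/-- The `p` vertices starting at `a` form a bubble. -/
def IsBubbleAt {n : ℕ} (a p : ℕ) (D : LinearChordDiagram n) : Prop :=
  (∀ i : Fin (2 * n), a ≤ i → (i : ℕ) < a + p → ¬ D.OnShortChord i) ∧
    (∀ c : Fin (2 * n), (c : ℕ) + 1 = a → D.OnShortChord c) ∧
    (∀ c : Fin (2 * n), (c : ℕ) = a + p → D.OnShortChord c)

open Classical in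
lemma card_bubbles_filter {n p : ℕ} (hp : 0 < p) (hpn : p ≤ 2 * n) (D : LinearChordDiagram n) :
    (D.bubbles.filter fun S => S.card = p).card =
      ((Finset.range (2 * n - p + 1)).filter fun a => D.IsBubbleAt a p).card := by
  symm
  refine Finset.card_bij
    (fun a _ => Finset.univ.filter fun i : Fin (2 * n) => a ≤ i ∧ (i : ℕ) < a + p) ?_ ?_ ?_
  · intro a ha
    obtain ⟨ha, h1, h2, h3⟩ := Finset.mem_filter.1 ha
    rw [Finset.mem_range] at ha
    have hS : (Finset.univ.filter fun i : Fin (2 * n) => a ≤ i ∧ (i : ℕ) < a + p) =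
        Finset.Icc ⟨a, by omega⟩ ⟨a + p - 1, by omega⟩ := by
      ext i
      simp only [Finset.mem_filter, Finset.mem_univ, true_and, Finset.mem_Icc, Fin.le_def]
      omega
    simp only [bubbles, Finset.mem_filter, Finset.mem_univ, true_and]
    refine ⟨⟨⟨a, by omega⟩, ⟨a + p - 1, by omega⟩, ?_, hS, ?_, h2, ?_⟩, ?_⟩
    · rw [Fin.le_def]; simp only; omega
    · intro i hi
      simp only [Finset.mem_filter, Finset.mem_univ, true_and] at hi
      exact h1 i hi.1 hi.2
    · intro c hc
      exact h3 c (by simp only at hc; omega)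
    · rw [hS, Fin.card_Icc]
      simp only
      omega
  · intro a ha b hb h
    have ha := Finset.mem_range.1 (Finset.mem_filter.1 ha).1
    have hb := Finset.mem_range.1 (Finset.mem_filter.1 hb).1
    have e1 := Finset.ext_iff.1 h ⟨a, by omega⟩
    have e2 := Finset.ext_iff.1 h ⟨b, by omega⟩
    simp only [Finset.mem_filter, Finset.mem_univ, true_and] at e1 e2
    omega
  · intro S hS
    simp only [bubbles, Finset.mem_filter, Finset.mem_univ, true_and] at hS
    obtain ⟨⟨a, b, hab, rfl, h1, h2, h3⟩, hc⟩ := hS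
    rw [Fin.card_Icc] at hc
    have hab' : (a : ℕ) ≤ b := hab
    refine ⟨a, ?_, ?_⟩
    · simp only [Finset.mem_filter, Finset.mem_range]
      refine ⟨by omega, fun i hi hi' => h1 i ?_, h2, fun c hc => h3 c (by omega)⟩
      simp only [Finset.mem_Icc, Fin.le_def]
      omega
    · ext i
      simp only [Finset.mem_filter, Finset.mem_univ, true_and, Finset.mem_Icc, Fin.le_def]
      omega

lemma bubbleCount_eq_sum {n p : ℕ} (hp : 0 < p) (hpn : p ≤ 2 * n) :
    bubbleCount n p = ∑ a ∈ Finset.range (2 * n - p + 1),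
      {D : LinearChordDiagram n | D.IsBubbleAt a p}.ncard := by
  classical
  unfold bubbleCount
  simp only [card_bubbles_filter hp hpn, Finset.card_filter]
  rw [Finset.sum_comm]
  refine Finset.sum_congr rfl fun a _ => ?_
  rw [← Finset.card_filter, ← Set.ncard_coe_finset, Finset.coe_filter_univ]

/-- The path of the `p` consecutive vertices starting at `a`. -/
def block {n : ℕ} (a p : ℕ) (h : a + p ≤ 2 * n) (i : Fin p) : Fin (2 * n) :=
  ⟨a + i, by omega⟩

lemma block_injective {n : ℕ} (a p : ℕ) (h : a + p ≤ 2 * n) :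
    Function.Injective (block a p h) := by
  intro i j e
  have := congrArg Fin.val e
  simp only [block] at this
  exact Fin.ext (by omega)

/-- If the vertices next to a block lie on short chords that leave the block, then no vertex of the
block is on a short chord as soon as consecutive vertices of the block are not joined. -/
lemma not_onShortChord_of_avoids {n : ℕ} {a p : ℕ} (h : a + p ≤ 2 * n) {D : LinearChordDiagram n}
    (hD : Pairing.Avoids (block a p h) D)
    (hl : ∀ c : Fin (2 * n), (c : ℕ) + 1 = a → (D.1 c : ℕ) + 1 = c)
    (hr : ∀ c : Fin (2 * n), (c : ℕ) = a + p → (D.1 c : ℕ) = c + 1)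
    (i : Fin (2 * n)) (hi : a ≤ i) (hi' : (i : ℕ) < a + p) : ¬ D.OnShortChord i := by
  have key : ∀ i : Fin (2 * n), a ≤ i → (i : ℕ) + 1 < a + p → (D.1 i : ℕ) ≠ i + 1 := by
    intro i hi hi' e
    refine hD ⟨i - a, by omega⟩ ⟨i - a + 1, by omega⟩ rfl ?_
    have : block a p h ⟨i - a, by omega⟩ = i := Fin.ext (by simp only [block]; omega)
    rw [this]
    exact Fin.ext (by simp only [block]; omega)
  have hinv : D.1 (D.1 i) = i := Pairing.apply_apply D i
  rintro (e | e)
  · by_cases hlast : (i : ℕ) + 1 < a + p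
    · exact key i hi hlast e
    · have := hr (D.1 i) (by omega)
      rw [hinv] at this
      omega
  · by_cases hfirst : a < i
    · refine key (D.1 i) (by omega) (by omega) ?_
      rw [hinv]
      exact e
    · have := hl (D.1 i) (by omega)
      rw [hinv] at this
      omega

lemma avoids_of_not_onShortChord {n : ℕ} {a p : ℕ} (h : a + p ≤ 2 * n) {D : LinearChordDiagram n}
    (hD : ∀ i : Fin (2 * n), a ≤ i → (i : ℕ) < a + p → ¬ D.OnShortChord i) :
    Pairing.Avoids (block a p h) D := by
  intro i j hij e
  refine hD (block a p h i) (by simp [block]) (by simp [block]) (Or.inl ?_)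
  rw [e]
  simp only [block]
  omega

/-- If the short chord entered the block, its other endpoint would be a bubble vertex on a short
chord. -/
lemma IsBubbleAt.apply_left {n a p : ℕ} (hp : 0 < p) {D : LinearChordDiagram n}
    (hD : D.IsBubbleAt a p) (c : Fin (2 * n)) (hc : (c : ℕ) + 1 = a) : (D.1 c : ℕ) + 1 = c := by
  have hinv : D.1 (D.1 c) = c := Pairing.apply_apply D c
  rcases hD.2.1 c hc with e | e
  · exact absurd (Or.inr (by rw [hinv]; exact e)) (hD.1 (D.1 c) (by omega) (by omega))
  · exact e.symm

lemma IsBubbleAt.apply_right {n a p : ℕ} (hp : 0 < p) {D : LinearChordDiagram n}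
    (hD : D.IsBubbleAt a p) (c : Fin (2 * n)) (hc : (c : ℕ) = a + p) : (D.1 c : ℕ) = c + 1 := by
  have hinv : D.1 (D.1 c) = c := Pairing.apply_apply D c
  rcases hD.2.2 c hc with e | e
  · exact e
  · exact absurd (Or.inl (by rw [hinv]; exact e)) (hD.1 (D.1 c) (by omega) (by omega))

/-- The boundary chords are forced outward, so the bubble condition becomes prescribed pairs plus
path avoidance, which the counts above handle. -/
lemma isBubbleAt_iff {n a p : ℕ} (hp : 0 < p) (h : a + p ≤ 2 * n) (D : LinearChordDiagram n) :
    D.IsBubbleAt a p ↔ (∀ c : Fin (2 * n), (c : ℕ) + 1 = a → (D.1 c : ℕ) + 1 = c) ∧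
      (∀ c : Fin (2 * n), (c : ℕ) = a + p → (D.1 c : ℕ) = c + 1) ∧
      Pairing.Avoids (block a p h) D :=
  ⟨fun hD => ⟨hD.apply_left hp, hD.apply_right hp, avoids_of_not_onShortChord h hD.1⟩,
   fun hD => ⟨not_onShortChord_of_avoids h hD.2.2 hD.1 hD.2.1,
    fun c hc => Or.inr (hD.1 c hc).symm, fun c hc => Or.inl (hD.2.1 c hc)⟩⟩

lemma left_iff {n a : ℕ} (h : a + 2 ≤ 2 * n) (D : LinearChordDiagram n) :
    (∀ c : Fin (2 * n), (c : ℕ) + 1 = a + 2 → (D.1 c : ℕ) + 1 = c) ↔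
      D.1 ⟨a, by omega⟩ = ⟨a + 1, by omega⟩ := by
  rw [Pairing.apply_eq_iff D]
  constructor
  · intro hc
    exact Fin.ext (by have := hc ⟨a + 1, by omega⟩ rfl; simp only at this ⊢; omega)
  · intro e c hc
    have : c = ⟨a + 1, by omega⟩ := Fin.ext (by simp only; omega)
    rw [this, e]

lemma right_iff {n b : ℕ} (h : b + 2 ≤ 2 * n) (D : LinearChordDiagram n) :
    (∀ c : Fin (2 * n), (c : ℕ) = b → (D.1 c : ℕ) = c + 1) ↔
      D.1 ⟨b, by omega⟩ = ⟨b + 1, by omega⟩ := by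
  constructor
  · intro hc
    exact Fin.ext (hc ⟨b, by omega⟩ rfl)
  · intro e c hc
    have : c = ⟨b, by omega⟩ := Fin.ext hc
    rw [this, e]

lemma ncard_isBubbleAt_zero {m p : ℕ} (hp : 0 < p) (h : p ≤ 2 * m) :
    ({D : LinearChordDiagram (m + 1) | D.IsBubbleAt 0 p}.ncard : ℝ) =
      pathAvoiding m p := by
  rw [← Pairing.ncard_apply_eq_and_avoids (V := Fin (2 * (m + 1))) (m := m) (by simp)
    (block 0 p (by omega)) (block_injective _ _ _) (u := ⟨p, by omega⟩) (v := ⟨p + 1, by omega⟩)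
    (by simp) (fun i => by simp only [block, ne_eq, Fin.mk.injEq]; omega)]
  congr 2
  ext D
  rw [Set.mem_ofPred_eq, Set.mem_ofPred_eq, isBubbleAt_iff hp (by omega)]
  simp only [zero_add, right_iff (n := m + 1) (b := p) (by omega)]
  simp

lemma ncard_isBubbleAt_last {m p : ℕ} (hp : 0 < p) (h : p ≤ 2 * m) :
    ({D : LinearChordDiagram (m + 1) | D.IsBubbleAt (2 * (m + 1) - p) p}.ncard : ℝ) = pathAvoiding m p := by
  obtain ⟨a, ha⟩ : ∃ a, 2 * (m + 1) - p = a + 2 := ⟨2 * (m + 1) - p - 2, by omega⟩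
  rw [ha, ← Pairing.ncard_apply_eq_and_avoids (V := Fin (2 * (m + 1))) (m := m) (by simp)
    (block (a + 2) p (by omega)) (block_injective _ _ _) (u := ⟨a, by omega⟩)
    (v := ⟨a + 1, by omega⟩)
    (by simp) (fun i => by simp only [block, ne_eq, Fin.mk.injEq]; omega)]
  congr 2
  ext D
  rw [Set.mem_ofPred_eq, Set.mem_ofPred_eq, isBubbleAt_iff hp (by omega), left_iff (by omega)]
  have : ∀ c : Fin (2 * (m + 1)), (c : ℕ) ≠ a + 2 + p := fun c => by omega
  simp [this]

lemma ncard_isBubbleAt_middle {m a p : ℕ} (hp : 0 < p) (h : a + p ≤ 2 * m) :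
    ({D : LinearChordDiagram (m + 2) | D.IsBubbleAt (a + 2) p}.ncard : ℝ) = pathAvoiding m p := by
  rw [← Pairing.ncard_apply_eq_and_apply_eq_and_avoids (V := Fin (2 * (m + 2))) (m := m) (by simp)
    (block (a + 2) p (by omega)) (block_injective _ _ _) (u := ⟨a, by omega⟩)
    (v := ⟨a + 1, by omega⟩) (u' := ⟨a + 2 + p, by omega⟩) (v' := ⟨a + 2 + p + 1, by omega⟩)
    (by simp) (by simp) (by simp only [ne_eq, Fin.mk.injEq]; omega)
    (by simp only [ne_eq, Fin.mk.injEq]; omega)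
    (fun i => by simp only [block, ne_eq, Fin.mk.injEq]; omega)
    (fun i => by simp only [block, ne_eq, Fin.mk.injEq]; omega)]
  congr 2
  ext D
  rw [Set.mem_ofPred_eq, Set.mem_ofPred_eq, isBubbleAt_iff hp (by omega), left_iff (by omega), right_iff (by omega)]

/-- A single vertex outside the block leaves no room for an outward short chord. -/
lemma not_isBubbleAt_one {n p : ℕ} (hp : 0 < p) (hn : 0 < n) (D : LinearChordDiagram n) :
    ¬ D.IsBubbleAt 1 p := by
  intro hD
  have := hD.apply_left hp ⟨0, by omega⟩ rfl
  simp at this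

lemma not_isBubbleAt_penultimate {n a p : ℕ} (hp : 0 < p) (h : a + p + 1 = 2 * n)
    (D : LinearChordDiagram n) : ¬ D.IsBubbleAt a p := by
  intro hD
  have h1 := hD.apply_right hp ⟨a + p, by omega⟩ rfl
  have h2 := (D.1 ⟨a + p, by omega⟩).2
  simp only at h1
  omega

/-- The two end positions force one chord each, the interior positions force two, and the positions
leaving exactly one vertex on a side contribute nothing. -/
lemma bubbleCount_eq {m p : ℕ} (hp : 0 < p) (h : p ≤ 2 * m + 2) :
    (bubbleCount (m + 2) p : ℝ) =
      2 * pathAvoiding (m + 1) p + ((2 * m + 1 - p : ℕ) : ℝ) * pathAvoiding m p := by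
  rw [bubbleCount_eq_sum hp (by omega), Nat.cast_sum]
  have h0 := ncard_isBubbleAt_zero (m := m + 1) hp (by omega)
  have hl := ncard_isBubbleAt_last (m := m + 1) hp (by omega)
  have h1 : {D : LinearChordDiagram (m + 2) | D.IsBubbleAt 1 p} = ∅ :=
    Set.eq_empty_of_forall_notMem fun D => not_isBubbleAt_one hp (by omega) D
  have hpen : {D : LinearChordDiagram (m + 2) | D.IsBubbleAt (2 * m + 3 - p) p} = ∅ :=
    Set.eq_empty_of_forall_notMem fun D => not_isBubbleAt_penultimate hp (by omega) D
  rw [show 2 * (m + 2) - p + 1 = (2 * m + 2 - p) + 1 + 1 + 1 by omega,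
    Finset.sum_range_succ, show (2 * m + 2 - p) + 1 + 1 = 2 * (m + 1 + 1) - p by omega, hl]
  rcases Nat.lt_or_ge (2 * m + 1) p with hlt | hle
  -- Here the two impossible positions coincide at 1; the truncated coefficient is 0, whereas 2m + 1
  -- - p would be -1.
  · obtain rfl : p = 2 * m + 2 := by omega
    rw [show 2 * (m + 1 + 1) - (2 * m + 2) = 2 by omega, Finset.sum_range_succ,
      Finset.sum_range_one, h0, h1, show 2 * m + 1 - (2 * m + 2) = 0 by omega]
    simp
    ring
  · rw [show 2 * (m + 1 + 1) - p = (2 * m + 1 - p) + 1 + 1 + 1 by omega, Finset.sum_range_succ,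
      show (2 * m + 1 - p) + 1 + 1 = 2 * m + 3 - p by omega, hpen,
      show 2 * m + 3 - p = (2 * m + 1 - p) + 1 + 1 by omega, Finset.sum_range_succ',
      Finset.sum_range_succ', h0, zero_add, h1]
    have : ∀ a ∈ Finset.range (2 * m + 1 - p),
        ({D : LinearChordDiagram (m + 2) | D.IsBubbleAt (a + 1 + 1) p}.ncard : ℝ) = pathAvoiding m p := by
      intro a ha
      have := Finset.mem_range.1 ha
      exact ncard_isBubbleAt_middle hp (by omega)
    rw [Finset.sum_congr rfl this]
    simp
    ring

end LinearChordDiagram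

/-! ### The total number of bubbles -/

/-- One copy of A_{m+1}(q) telescopes through the recursion; the other cancels, up to boundary
terms, against the summation by parts of the weighted sum. The coefficient is a real difference, so
the identity holds for every `K`. -/
lemma sum_range_pathAvoiding (m K : ℕ) :
    ∑ q ∈ Finset.Icc 1 K, (2 * pathAvoiding (m + 1) q +
        (2 * m + 1 - q : ℝ) * pathAvoiding m q) =
      pathAvoiding (m + 2) 2 + (2 * m + 1) * pathAvoiding (m + 1) 2 + pathAvoiding (m + 1) 1 -
        pathAvoiding (m + 2) (K + 2) - (2 * m + 1 - K) * pathAvoiding (m + 1) (K + 2) -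
        pathAvoiding (m + 1) (K + 1) := by
  induction K with
  | zero => simp; ring
  | succ K ih =>
    rw [Finset.sum_Icc_succ_top (by omega), ih]
    have h1 := pathAvoiding_add_two (m + 1) (K + 1)
    have h2 := pathAvoiding_add_two m (K + 1)
    simp only [add_assoc, Nat.reduceAdd] at h1 h2 ⊢
    rw [h1, h2]
    push_cast
    ring

lemma sum_pathAvoiding (m : ℕ) :
    ∑ q ∈ Finset.Icc 1 (2 * m + 2), (2 * pathAvoiding (m + 1) q +
        ((2 * m + 1 - q : ℕ) : ℝ) * pathAvoiding m q) =
      (oddFactorial (m + 2) - oddFactorial (m + 1)) +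
        (2 * m + 1) * (oddFactorial (m + 1) - oddFactorial m) + oddFactorial (m + 1) -
        pathAvoiding (m + 2) (2 * m + 4) := by
  have h0 : ∑ q ∈ Finset.Icc 1 (2 * m + 1), (2 * pathAvoiding (m + 1) q +
        ((2 * m + 1 - q : ℕ) : ℝ) * pathAvoiding m q) =
      ∑ q ∈ Finset.Icc 1 (2 * m + 1), (2 * pathAvoiding (m + 1) q +
        (2 * m + 1 - q : ℝ) * pathAvoiding m q) := by
    refine Finset.sum_congr rfl fun q hq => ?_
    rw [Nat.cast_sub (Finset.mem_Icc.1 hq).2]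
    push_cast
    ring
  have h1 := pathAvoiding_add_two (m + 1) (2 * m + 2)
  have h2 := pathAvoiding_add_two m 0
  have h3 := pathAvoiding_add_two (m + 1) 0
  simp only [add_assoc, Nat.reduceAdd, zero_add, pathAvoiding_zero, pathAvoiding_one] at h1 h2 h3
  -- The top term q = 2m + 2 is split off because only there does truncation change the coefficient.
  rw [Finset.sum_Icc_succ_top (by omega), h0, sum_range_pathAvoiding,
    show 2 * m + 1 - (2 * m + 1 + 1) = 0 by omega]
  simp only [add_assoc, Nat.reduceAdd, pathAvoiding_one]
  rw [h1, h2, h3]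
  push_cast
  ring

/-! ### Asymptotics of path-avoiding pairings -/

lemma oddFactorial_ratio {m j : ℕ} (h : j ≤ m) :
    (oddFactorial (m - j) : ℝ) / oddFactorial m =
      ∏ i ∈ Finset.range j, ((2 * m - 1 - 2 * i : ℝ))⁻¹ := by
  induction j with
  | zero =>
    have := oddFactorial_pos m
    simp [this.ne']
  | succ j ih =>
    rw [Finset.prod_range_succ, ← ih (by omega)]
    obtain ⟨k, rfl⟩ : ∃ k, m = k + (j + 1) := ⟨m - (j + 1), by omega⟩
    rw [show k + (j + 1) - j = k + 1 by omega, show k + (j + 1) - (j + 1) = k by omega,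
      oddFactorial_succ]
    have h1 : (2 * ((k + (j + 1) : ℕ) : ℝ) - 1 - 2 * j) = 2 * k + 1 := by push_cast; ring
    have h2 : (2 * k + 1 : ℝ) ≠ 0 := by positivity
    rw [h1]
    push_cast
    field_simp

lemma choose_eq_prod (k j : ℕ) :
    (k.choose j : ℝ) = (∏ i ∈ Finset.range j, ((k - i : ℕ) : ℝ)) / j.factorial := by
  rw [eq_div_iff (by positivity), mul_comm, ← Nat.cast_mul, ← Nat.descFactorial_eq_factorial_mul_choose,
    Nat.descFactorial_eq_prod_range]
  push_cast
  rfl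

lemma choose_mul_ratio (p : ℕ) {m j : ℕ} (h : j ≤ m) :
    ((p - j).choose j : ℝ) * oddFactorial (m - j) / oddFactorial m =
      (∏ i ∈ Finset.range j, (((p - j - i : ℕ) : ℝ) / (2 * m - 1 - 2 * i))) / j.factorial := by
  rw [mul_div_assoc, oddFactorial_ratio h, choose_eq_prod, div_mul_eq_mul_div,
    ← Finset.prod_mul_distrib]
  rfl

/-- Each numerator exceeds its denominator by at most 2, and each denominator is at least 1, so each
factor is at most 3. The bound is uniform in m, as domination requires. -/
lemma choose_mul_ratio_le {p m j : ℕ} (h : j ≤ m) (hp : p ≤ 2 * m + 2) :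
    ((p - j).choose j : ℝ) * oddFactorial (m - j) / oddFactorial m ≤ 3 ^ j / j.factorial := by
  rw [choose_mul_ratio p h]
  gcongr
  rw [← Finset.card_range j, ← Finset.prod_const, Finset.card_range]
  have key : ∀ i ∈ Finset.range j, (1 : ℝ) ≤ 2 * m - 1 - 2 * i := by
    intro i hi
    have : 2 * i + 2 ≤ 2 * m := by have := Finset.mem_range.1 hi; omega
    have : (2 * i + 2 : ℝ) ≤ 2 * m := by exact_mod_cast this
    linarith
  apply Finset.prod_le_prod
  · intro i hi
    exact div_nonneg (by positivity) (by linarith [key i hi])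
  · intro i hi
    have h1 := key i hi
    rw [div_le_iff₀ (by linarith)]
    have : p - j - i + 2 * i ≤ 2 * m + 1 := by have := Finset.mem_range.1 hi; omega
    have : ((p - j - i : ℕ) : ℝ) + 2 * i ≤ 2 * m + 1 := by exact_mod_cast this
    linarith

lemma tendsto_choose_mul_ratio {y : ℝ} (hy : 0 ≤ y) (p : ℕ → ℕ)
    (hpy : Tendsto (fun m : ℕ => (p m : ℝ) / m) atTop (𝓝 y)) (j : ℕ) :
    Tendsto (fun m : ℕ => ((p m - j).choose j : ℝ) * oddFactorial (m - j) / oddFactorial m)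
      atTop (𝓝 ((y / 2) ^ j / j.factorial)) := by
  have hinv : Tendsto (fun m : ℕ => (m : ℝ)⁻¹) atTop (𝓝 0) := tendsto_inv_atTop_nhds_zero_nat
  have main : ∀ i, Tendsto (fun m : ℕ => (((p m - j - i : ℕ) : ℝ) / (2 * m - 1 - 2 * i)))
      atTop (𝓝 (y / 2)) := by
    intro i
    -- The maximum with 0 reproduces truncated subtraction, and is harmless in the limit since y ≥
    -- 0.
    have h1 : Tendsto (fun m : ℕ => max ((p m : ℝ) / m - (j + i) * (m : ℝ)⁻¹) 0) atTop (𝓝 y) := by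
      have := (hpy.sub (hinv.const_mul (j + i : ℝ))).max (tendsto_const_nhds (x := (0 : ℝ)))
      simpa [hy] using this
    have h2 : Tendsto (fun m : ℕ => 2 - (1 + 2 * i) * (m : ℝ)⁻¹) atTop (𝓝 2) := by
      simpa using (tendsto_const_nhds (x := (2 : ℝ))).sub (hinv.const_mul (1 + 2 * i : ℝ))
    refine (h1.div h2 two_ne_zero).congr' ?_
    filter_upwards [eventually_gt_atTop 0] with m hm
    have hm' : (0 : ℝ) < m := by exact_mod_cast hm
    have e1 : ((p m - j - i : ℕ) : ℝ) = m * max ((p m : ℝ) / m - (j + i) * (m : ℝ)⁻¹) 0 := by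
      rw [mul_max_of_nonneg _ _ hm'.le, mul_zero, mul_sub, mul_div_cancel₀ _ hm'.ne',
        mul_left_comm, mul_inv_cancel₀ hm'.ne', mul_one]
      rcases le_total (j + i) (p m) with h | h
      · have h' : (j + i : ℝ) ≤ p m := by exact_mod_cast h
        rw [max_eq_left (by linarith), Nat.sub_sub, Nat.cast_sub h]
        push_cast; ring
      · have h' : (p m : ℝ) ≤ j + i := by exact_mod_cast h
        rw [max_eq_right (by linarith), Nat.sub_sub, Nat.sub_eq_zero_of_le h, Nat.cast_zero]
    have e2 : (2 * m - 1 - 2 * i : ℝ) = m * (2 - (1 + 2 * i) * (m : ℝ)⁻¹) := by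
      field_simp
      ring
    simp only [Pi.div_apply]
    rw [e1, e2, mul_div_mul_left _ _ hm'.ne']
  have h := (tendsto_finsetProd (Finset.range j) fun i _ => main i).div_const (j.factorial : ℝ)
  simp only [Finset.prod_const, Finset.card_range] at h
  refine h.congr' ?_
  filter_upwards [eventually_ge_atTop j] with m hm
  rw [choose_mul_ratio (p m) hm]

/-- Termwise, the inclusion-exclusion sum tends to the exponential series at -y/2, dominated by
3^j/j!. Values p > 2m, where only the formula has meaning, are allowed because they occur in
`LinearChordDiagram.bubbleCount_eq`, with coefficient 0. -/
lemma tendsto_pathAvoiding {y : ℝ} (hy : 0 ≤ y) (p : ℕ → ℕ)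
    (hp : ∀ᶠ m in atTop, p m ≤ 2 * m + 2)
    (hpy : Tendsto (fun m : ℕ => (p m : ℝ) / m) atTop (𝓝 y)) :
    Tendsto (fun m : ℕ => pathAvoiding m (p m) / oddFactorial m) atTop
      (𝓝 (Real.exp (-y / 2))) := by
  let F : ℕ → ℕ → ℝ := fun m j => if j ≤ m then
    (-1) ^ j * (((p m - j).choose j : ℝ) * oddFactorial (m - j) / oddFactorial m) else 0
  have h1 : ∀ m, pathAvoiding m (p m) / oddFactorial m = ∑' j, F m j := by
    intro m
    rw [tsum_eq_sum (s := Finset.range (m + 1)), pathAvoiding, Finset.sum_div]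
    · refine Finset.sum_congr rfl fun j hj => ?_
      rw [show F m j = _ from if_pos (by have := Finset.mem_range.1 hj; omega)]
      ring
    · intro j hj
      exact if_neg (by simpa using hj)
  have h2 : Real.exp (-y / 2) = ∑' j : ℕ, (-1) ^ j * ((y / 2) ^ j / j.factorial) := by
    rw [Real.exp_eq_exp_ℝ, NormedSpace.exp_eq_tsum_div]
    refine tsum_congr fun j => ?_
    rw [neg_div, neg_pow, mul_div_assoc]
  simp only [h1, h2]
  refine tendsto_tsum_of_dominated_convergence (bound := fun j => 3 ^ j / (j.factorial : ℝ))
    (Real.summable_pow_div_factorial 3) ?_ ?_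
  · intro j
    refine ((tendsto_choose_mul_ratio hy p hpy j).const_mul ((-1) ^ j)).congr' ?_
    filter_upwards [eventually_ge_atTop j] with m hm
    exact (if_pos hm).symm
  · filter_upwards [hp] with m hm j
    by_cases hj : j ≤ m
    · rw [show F m j = _ from if_pos hj, norm_mul, norm_pow, norm_neg, norm_one, one_pow, one_mul,
        Real.norm_of_nonneg (by positivity)]
      exact choose_mul_ratio_le hj hm
    · rw [show F m j = _ from if_neg hj, norm_zero]
      positivity

/-! ### Passage to the limit -/

lemma sum_bubbleCount (m : ℕ) :
    ∑ q ∈ Finset.Icc 1 (2 * (m + 2) - 2), (bubbleCount (m + 2) q : ℝ) =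
      (oddFactorial (m + 2) - oddFactorial (m + 1)) +
        (2 * m + 1) * (oddFactorial (m + 1) - oddFactorial m) + oddFactorial (m + 1) -
        pathAvoiding (m + 2) (2 * m + 4) := by
  rw [← sum_pathAvoiding, show 2 * (m + 2) - 2 = 2 * m + 2 by omega]
  refine Finset.sum_congr rfl fun q hq => ?_
  have := Finset.mem_Icc.1 hq
  exact LinearChordDiagram.bubbleCount_eq (by omega) this.2

lemma tendsto_linear_div_linear (a b c d : ℝ) (hc : c ≠ 0) :
    Tendsto (fun m : ℕ => (a * m + b) / (c * m + d)) atTop (𝓝 (a / c)) := by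
  have hinv : Tendsto (fun m : ℕ => (m : ℝ)⁻¹) atTop (𝓝 0) := tendsto_inv_atTop_nhds_zero_nat
  have h : Tendsto (fun m : ℕ => (a + b * (m : ℝ)⁻¹) / (c + d * (m : ℝ)⁻¹)) atTop (𝓝 (a / c)) := by
    have := ((hinv.const_mul b).const_add a).div ((hinv.const_mul d).const_add c) (by simpa)
    rwa [mul_zero, mul_zero, add_zero, add_zero] at this
  refine h.congr' ?_
  filter_upwards [eventually_gt_atTop 0] with m hm
  have hm' : (m : ℝ) ≠ 0 := by exact_mod_cast hm.ne'
  rw [← mul_div_mul_right _ _ hm']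
  congr 1 <;> field_simp

/-- Numerator and denominator are divided by (2n-1)!! with n = m + 2. The linear fractions keep
trivial coefficients so as to match `tendsto_linear_div_linear`. -/
lemma bubble_ratio_eq {m p : ℕ} (hp : 0 < p) (h : p ≤ 2 * m + 2) :
    (((m + 2 : ℕ) : ℝ) - 1) * (bubbleCount (m + 2) p : ℝ) /
        ∑ q ∈ Finset.Icc 1 (2 * (m + 2) - 2), (bubbleCount (m + 2) q : ℝ) =
      ((1 * m + 1) / (2 * m + 3) * (2 * (pathAvoiding (m + 1) p / oddFactorial (m + 1)) +
        ((2 * m + 1 - p : ℕ) : ℝ) / (2 * m + 1) * (pathAvoiding m p / oddFactorial m))) /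
      (1 + (2 * m + 0) / (2 * m + 3) -
        pathAvoiding (m + 2) (2 * (m + 2)) / oddFactorial (m + 2)) := by
  have hD : (oddFactorial m : ℝ) ≠ 0 := by exact_mod_cast (oddFactorial_pos m).ne'
  have hD2 : (oddFactorial (m + 2) : ℝ) ≠ 0 := by exact_mod_cast (oddFactorial_pos (m + 2)).ne'
  have h1 : (2 * m + 1 : ℝ) ≠ 0 := by positivity
  have h3 : (2 * m + 3 : ℝ) ≠ 0 := by positivity
  have e1 : (oddFactorial (m + 1) : ℝ) = (2 * m + 1) * oddFactorial m := by
    rw [oddFactorial_succ]; push_cast; ring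
  have e2 : (oddFactorial (m + 2) : ℝ) = (2 * m + 3) * ((2 * m + 1) * oddFactorial m) := by
    rw [oddFactorial_succ (m + 1), Nat.cast_mul, e1]; push_cast; ring
  rw [sum_bubbleCount, LinearChordDiagram.bubbleCount_eq hp h, show 2 * (m + 2) = 2 * m + 4 by ring,
    ← div_div_div_cancel_right₀ hD2]
  congr 1
  · rw [e1, e2]
    push_cast
    field_simp
    ring
  · rw [e1, e2]
    field_simp
    ring

theorem theorem6 (x : ℝ) (hx : x ∈ Set.Ioc (0 : ℝ) 2) (p : ℕ → ℕ)
    (hp : ∀ᶠ n : ℕ in atTop, p n + 2 ≤ 2 * n)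
    (hpx : Tendsto (fun n : ℕ => (p n : ℝ) / ((n : ℝ) - 1)) atTop (𝓝 x)) :
    Tendsto
      (fun n : ℕ => ((n : ℝ) - 1) * (bubbleCount n (p n) : ℝ) /
        ∑ q ∈ Finset.Icc 1 (2 * n - 2), (bubbleCount n q : ℝ))
      atTop
      (𝓝 (Real.exp 1 * (6 - x) / (2 * (4 * Real.exp 1 - 2)) * Real.exp (-x / 2))) := by
  have hp1 : ∀ᶠ k in atTop, p (k + 1) ≤ 2 * k :=
    ((tendsto_add_atTop_nat 1).eventually hp).mono fun k hk => by omega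
  have hp2 : ∀ᶠ m in atTop, p (m + 2) ≤ 2 * m + 2 :=
    ((tendsto_add_atTop_nat 2).eventually hp).mono fun k hk => by omega
  have hpx1 : Tendsto (fun k : ℕ => (p (k + 1) : ℝ) / k) atTop (𝓝 x) := by
    refine (hpx.comp (tendsto_add_atTop_nat 1)).congr fun k => ?_
    simp
  have hpx2 : Tendsto (fun m : ℕ => (p (m + 2) : ℝ) / m) atTop (𝓝 x) := by
    have h := (hpx1.comp (tendsto_add_atTop_nat 1)).mul
      (tendsto_linear_div_linear 1 1 1 0 one_ne_zero)
    rw [div_one, mul_one] at h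
    refine h.congr fun m => ?_
    have : (m + 1 : ℝ) ≠ 0 := by positivity
    simp only [Function.comp, one_mul, add_zero]
    push_cast
    rw [div_mul_div_cancel₀ this]
  -- The count of bubbles by position needs p > 0, which x > 0 guarantees eventually.
  have hpos : ∀ᶠ m in atTop, 0 < p (m + 2) := by
    filter_upwards [hpx2.eventually (lt_mem_nhds hx.1)] with m hm
    by_contra h
    simp [Nat.eq_zero_of_not_pos h] at hm
  have hA : Tendsto (fun m : ℕ => pathAvoiding (m + 1) (p (m + 2)) / oddFactorial (m + 1)) atTop
      (𝓝 (Real.exp (-x / 2))) :=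
    (tendsto_pathAvoiding hx.1.le (fun k => p (k + 1)) (hp1.mono fun k hk => by omega)
      hpx1).comp (tendsto_add_atTop_nat 1)
  have hB := tendsto_pathAvoiding hx.1.le (fun m => p (m + 2)) hp2 hpx2
  -- The path through all vertices, y = 2: diagrams without short chords.
  have hC : Tendsto (fun m : ℕ => pathAvoiding (m + 2) (2 * (m + 2)) / oddFactorial (m + 2)) atTop
      (𝓝 (Real.exp (-1))) := by
    have h := tendsto_pathAvoiding zero_le_two (fun k => 2 * k)
      (Eventually.of_forall fun k => by omega) (by
        simpa using tendsto_linear_div_linear 2 0 1 0 one_ne_zero)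
    rw [show -(2 : ℝ) / 2 = -1 by norm_num] at h
    exact h.comp (tendsto_add_atTop_nat 2)
  -- For x = 2 the size may exceed 2m + 1; the maximum with 0 again accounts for truncation.
  have hT : Tendsto (fun m : ℕ => ((2 * m + 1 - p (m + 2) : ℕ) : ℝ) / (2 * m + 1)) atTop
      (𝓝 (1 - x / 2)) := by
    have h := ((hpx2.mul (tendsto_linear_div_linear 1 0 2 1 two_ne_zero)).const_sub 1).max
      (tendsto_const_nhds (x := (0 : ℝ)))
    rw [max_eq_left (by linarith [hx.2]), mul_one_div] at h
    refine h.congr' ?_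
    filter_upwards [eventually_gt_atTop 0] with m hm
    have hm' : (m : ℝ) ≠ 0 := by exact_mod_cast hm.ne'
    have h1 : (0 : ℝ) < 2 * m + 1 := by positivity
    rw [one_mul, add_zero, div_mul_div_cancel₀ hm']
    rcases le_total (p (m + 2)) (2 * m + 1) with h | h
    · have h' : (p (m + 2) : ℝ) ≤ 2 * m + 1 := by exact_mod_cast h
      rw [max_eq_left (by rw [sub_nonneg, div_le_one h1]; exact h'), Nat.cast_sub h]
      push_cast
      rw [sub_div, div_self h1.ne']
    · have h' : (2 * m + 1 : ℝ) ≤ p (m + 2) := by exact_mod_cast h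
      rw [max_eq_right (by rw [sub_nonpos, one_le_div h1]; exact h'), Nat.sub_eq_zero_of_le h]
      simp
  have hlt : Real.exp (-1) < 1 := by simp
  have main := ((tendsto_linear_div_linear 1 1 2 3 two_ne_zero).mul
    ((hA.const_mul 2).add (hT.mul hB))).div
    (((tendsto_linear_div_linear 2 0 2 3 two_ne_zero).const_add 1).sub hC)
    (by rw [div_self two_ne_zero]; linarith)
  rw [← tendsto_add_atTop_iff_nat 2]
  have hlim : Real.exp 1 * (6 - x) / (2 * (4 * Real.exp 1 - 2)) * Real.exp (-x / 2) =
      1 / 2 * (2 * Real.exp (-x / 2) + (1 - x / 2) * Real.exp (-x / 2)) /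
        (1 + 2 / 2 - Real.exp (-1)) := by
    have h1 : 1 < Real.exp 1 := by simp
    have h2 : 4 * Real.exp 1 - 2 ≠ 0 := by linarith
    have h3 : 1 + 2 / 2 - (Real.exp 1)⁻¹ = (4 * Real.exp 1 - 2) / (2 * Real.exp 1) := by
      field_simp
      ring
    rw [Real.exp_neg 1, h3]
    field_simp
    ring
  rw [hlim]
  refine main.congr' ?_
  filter_upwards [hp2, hpos] with m h1 h2
  exact (bubble_ratio_eq h2 h1).symm
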